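/- Let $M$ be a matroid of rank $r$ on the ground set $[n]=\{1,\dots,n\}$, let $\mathcal B_M$ be its set of bases, and let $\mu$ be the uniform probability distribution on $\mathcal B_M$. For $i\in[n]$ let $\mu_i=\Pr_{S\sim\mu}[i\in S]$ be the marginal probability of $i$. With $\log$ the natural logarithm and $0\log\frac10=0$, let $\mathcal H(\mu)=\sum_{S}\mu(S)\log\frac{1}{\mu(S)}$ denote the entropy of $\mu$, and for $p\in[0,1]$ let $\mathcal H(p)=p\log\frac1p+(1-p)\log\frac1{1-p}$. Then $\sum_{i=1}^n\mathcal H(\mu_i)$ is both an additive $r$-approximation and a multiplicative $2$-approximation to $\mathcal H(\mu)=\log|\mathcal B_M|$; that is, $\mathcal H(\mu)=\log|\mathcal B_M|$ and \[ \max\Big\{\tfrac12\sum_{i=1}^n\mathcal H(\mu_i),\ \sum_{i=1}^n\mathcal H(\mu_i)-r\Big\}\ \le\ \mathcal H(\mu)\ \le\ \sum_{i=1}^n\mathcal H(\mu_i). \] -/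

import Mathlib

namespace MatroidEntropy

open Classical in
/-- The family `B_M` of all bases of a matroid `M` on `[n]`, as a finite family of subsets. -/
noncomputable def bases {n : ℕ} (M : Matroid (Fin n)) : Finset (Finset (Fin n)) :=
  Finset.univ.filter fun B : Finset (Fin n) => M.IsBase (B : Set (Fin n))

theorem mem_bases {n : ℕ} (M : Matroid (Fin n)) (B : Finset (Fin n)) :
    B ∈ bases M ↔ M.IsBase (B : Set (Fin n)) := by
  simp [bases]

theorem bases_nonempty {n : ℕ} (M : Matroid (Fin n)) : (bases M).Nonempty := by
  classical
  obtain ⟨B, hB⟩ := M.exists_isBase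
  exact ⟨B.toFinset, by simpa [mem_bases] using hB⟩

/-- The uniform probability distribution on the bases of `M`. -/
noncomputable def uniformBases {n : ℕ} (M : Matroid (Fin n)) : PMF (Finset (Fin n)) :=
  PMF.uniformOfFinset (bases M) (bases_nonempty M)

/-- The Shannon entropy `∑ ω, μ(ω) log (1 / μ(ω))` (natural logarithm, terms with `μ(ω) = 0`
contribute `0`) of a probability distribution on a finite set. -/
noncomputable def entropy {Ω : Type*} [Fintype Ω] (μ : PMF Ω) : ℝ :=
  ∑ ω, (μ ω).toReal * Real.log (1 / (μ ω).toReal)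

/-- The marginal `μ_i`, the probability that `i ∈ S` for a random subset `S` with law `μ`. -/
noncomputable def marginal {n : ℕ} (μ : PMF (Finset (Fin n))) (i : Fin n) : ℝ :=
  ∑ S : Finset (Fin n) with i ∈ S, (μ S).toReal

end MatroidEntropy

/-! The upper bound is Gibbs' inequality against the product measure with the same marginals. The
lower bounds rest on `sum_marginal_mul_log_le`: `∑ μᵢ log (1/μᵢ) ≤ log |B_M|`. Applied to the dual
matroid, whose marginals are `1 - μᵢ`, it also bounds `∑ (1 - μᵢ) log (1/(1 - μᵢ))` by `log |B_M|`.
Adding the two gives the factor 2; bounding the second sum by `∑ μᵢ = r` instead gives the additive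
bound.

The key inequality holds base by base before averaging. Write `b(I)` for the number of bases
containing `I`; then for each base `S`, `(r - 1) log b(∅) ≤ ∑_{i ∈ S} log b({i})`. This follows by
induction along `S` from a negative-correlation statement for pairs, averaged over `S \ I`, which is
a reversed Cauchy–Schwarz inequality for the Hessian `pairCount M I` of the bases generating
polynomial.

That inequality is proved by trickling down: in a rank-two contraction the Hessian is the adjacency
matrix of a complete multipartite graph, whose parts are the parallel classes; in higher rank, the
inequalities for all `I ∪ {i}` sum to `A ≤ A D⁻¹ A`, which with connectedness forces `A` to have
only one positive direction. -/

namespace MatroidEntropy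

/-! ### Hyperbolic matrices and the local-to-global principle -/

/-- A symmetric nonnegative matrix `A` with row sums `d` is *hyperbolic at the all-ones vector*
if it satisfies the reversed Cauchy–Schwarz inequality against that vector. -/
def HyperbolicAtOne {ι : Type*} [Fintype ι] (A : ι → ι → ℝ) : Prop :=
  ∀ x : ι → ℝ, (∑ i, ∑ j, A i j) * ∑ i, ∑ j, x i * A i j * x j ≤ (∑ i, (∑ j, A i j) * x i) ^ 2

/-- Sufficient condition for hyperbolicity: nonpositivity on the complement of the all-ones
vector with respect to some weights `w` of nonzero total mass. -/
theorem hyperbolicAtOne_of_nonpos {ι : Type*} [Fintype ι] {A : ι → ι → ℝ}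
    (hsymm : ∀ i j, A i j = A j i) (h0 : ∀ i j, 0 ≤ A i j) (w : ι → ℝ) (hw : ∑ i, w i ≠ 0)
    (h : ∀ y : ι → ℝ, ∑ i, w i * y i = 0 → ∑ i, ∑ j, y i * A i j * y j ≤ 0) :
    HyperbolicAtOne A := by
  intro x
  set s := ∑ i, ∑ j, A i j with hs
  set t := (∑ i, w i * x i) / ∑ i, w i with ht
  have hs0 : 0 ≤ s := Finset.sum_nonneg fun i _ => Finset.sum_nonneg fun j _ => h0 i j
  have h1 := h (fun i => x i - t) (by
    simp only [mul_sub, Finset.sum_sub_distrib, ← Finset.sum_mul]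
    rw [ht]; field_simp; ring)
  have h2 : ∑ i, ∑ j, (x i - t) * A i j * (x j - t) =
      (∑ i, ∑ j, x i * A i j * x j) - 2 * t * (∑ i, (∑ j, A i j) * x i) + t ^ 2 * s := by
    have h3 : ∑ i, ∑ j, A i j * x j = ∑ i, (∑ j, A i j) * x i := by
      rw [Finset.sum_comm]
      refine Finset.sum_congr rfl fun i _ => ?_
      rw [Finset.sum_mul]
      exact Finset.sum_congr rfl fun j _ => by rw [hsymm]
    have h4 : ∀ i j, (x i - t) * A i j * (x j - t) =
        x i * A i j * x j - t * (A i j * x i) - t * (A i j * x j) + t ^ 2 * A i j := by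
      intro i j; ring
    simp only [h4, Finset.sum_add_distrib, Finset.sum_sub_distrib, ← Finset.mul_sum, h3,
      ← Finset.sum_mul, ← hs]
    ring
  rw [h2] at h1
  -- With `L` the row-sum form at `x`, multiplying by `s` gives `s * q(x) ≤ 2tsL - t²s² = L² - (L -
  -- ts)²`.
  nlinarith [sq_nonneg (∑ i, (∑ j, A i j) * x i - t * s), mul_le_mul_of_nonneg_left h1 hs0]

/-- An eigenvector of `D⁻¹ A` with positive eigenvalue vanishes if it is orthogonal to the
all-ones vector, `A ≤ A D⁻¹ A` as quadratic forms, and `A` is connected on its support. -/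
theorem eq_zero_of_eigenvector {ι : Type*} [Fintype ι] {A : ι → ι → ℝ}
    (hsymm : ∀ i j, A i j = A j i) (h0 : ∀ i j, 0 ≤ A i j) (d : ι → ℝ)
    (hd : ∀ i, ∑ j, A i j = d i)
    (hA : ∀ x : ι → ℝ, ∑ i, ∑ j, x i * A i j * x j ≤ ∑ i, (∑ j, A i j * x j) ^ 2 / d i)
    (hconn : ∀ y : ι → ℝ, (∀ i j, A i j ≠ 0 → y i = y j) →
      ∀ i j, d i ≠ 0 → d j ≠ 0 → y i = y j)
    (y : ι → ℝ) (m : ℝ) (hm : 0 < m) (hy : ∀ i, ∑ j, A i j * y j = m * (d i * y i))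
    (horth : ∑ i, d i * y i = 0) (i : ι) (hi : d i ≠ 0) : y i = 0 := by
  have hd0 : ∀ i, 0 ≤ d i := fun i => hd i ▸ Finset.sum_nonneg fun j _ => h0 i j
  set n := ∑ i, d i * y i ^ 2 with hn
  have hn0 : 0 ≤ n := Finset.sum_nonneg fun i _ => mul_nonneg (hd0 i) (sq_nonneg _)
  have hq : ∑ i, ∑ j, y i * A i j * y j = m * n := by
    rw [hn, Finset.mul_sum]
    refine Finset.sum_congr rfl fun i _ => ?_
    simp only [mul_assoc, ← Finset.mul_sum, hy]
    ring
  have h1 : m * n ≤ m ^ 2 * n := by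
    have h := hA y
    rw [hq] at h
    refine h.trans_eq ?_
    rw [hn, Finset.mul_sum]
    refine Finset.sum_congr rfl fun i _ => ?_
    rw [hy]
    rcases eq_or_ne (d i) 0 with h | h
    · simp [h]
    · field_simp
  -- Unless `n = 0`, the previous bound forces `m ≥ 1`; the Laplacian energy computed next is then
  -- both nonnegative and nonpositive.
  have h2 : n ≤ m * n := by
    by_contra! hlt
    nlinarith
  have h3 : ∑ i, ∑ j, A i j * (y i - y j) ^ 2 = 2 * n - 2 * (m * n) := by
    have e1 : ∑ i, ∑ j, A i j * y i ^ 2 = n := by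
      rw [hn]
      exact Finset.sum_congr rfl fun i _ => by rw [← Finset.sum_mul, hd]
    have e2 : ∑ i, ∑ j, A i j * y j ^ 2 = n := by
      rw [← e1, Finset.sum_comm]
      exact Finset.sum_congr rfl fun i _ => Finset.sum_congr rfl fun j _ => by rw [hsymm]
    have e3 : ∀ i j, A i j * (y i - y j) ^ 2 =
        A i j * y i ^ 2 + A i j * y j ^ 2 - 2 * (y i * A i j * y j) := by
      intro i j; ring
    simp only [e3, Finset.sum_add_distrib, Finset.sum_sub_distrib, ← Finset.mul_sum, e1, e2, hq]
    ring
  have h4 : ∀ i j, A i j ≠ 0 → y i = y j := by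
    intro i j hij
    have hnn : ∀ i j, 0 ≤ A i j * (y i - y j) ^ 2 :=
      fun i j => mul_nonneg (h0 i j) (sq_nonneg _)
    have h5 : ∑ i, ∑ j, A i j * (y i - y j) ^ 2 = 0 :=
      le_antisymm (by rw [h3]; linarith)
        (Finset.sum_nonneg fun i _ => Finset.sum_nonneg fun j _ => hnn i j)
    rw [Finset.sum_eq_zero_iff_of_nonneg
      (fun i _ => Finset.sum_nonneg fun j _ => hnn i j)] at h5
    have h6 := h5 i (Finset.mem_univ _)
    rw [Finset.sum_eq_zero_iff_of_nonneg (fun j _ => hnn i j)] at h6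
    have h7 := h6 j (Finset.mem_univ _)
    simpa [hij, sub_eq_zero] using h7
  have h5 : ∑ j, d j * y j = (∑ j, d j) * y i := by
    rw [Finset.sum_mul]
    refine Finset.sum_congr rfl fun j _ => ?_
    rcases eq_or_ne (d j) 0 with h | h
    · simp [h]
    · rw [hconn y h4 j i h hi]
  rw [h5] at horth
  have h6 : d i ≤ ∑ j, d j := Finset.single_le_sum (fun j _ => hd0 j) (Finset.mem_univ i)
  have h7 : 0 < d i := lt_of_le_of_ne (hd0 i) (Ne.symm hi)
  exact (mul_eq_zero.1 horth).resolve_left (by linarith)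

/-- Local-to-global principle: a connected nonnegative symmetric matrix with `A ≤ A D⁻¹ A`, where
`D` is the diagonal matrix of row sums, is hyperbolic at the all-ones vector. -/
theorem hyperbolicAtOne_of_le {ι : Type*} [Fintype ι] {A : ι → ι → ℝ}
    (hsymm : ∀ i j, A i j = A j i) (h0 : ∀ i j, 0 ≤ A i j)
    (hA : ∀ x : ι → ℝ, ∑ i, ∑ j, x i * A i j * x j ≤
      ∑ i, (∑ j, A i j * x j) ^ 2 / ∑ j, A i j)
    (hconn : ∀ y : ι → ℝ, (∀ i j, A i j ≠ 0 → y i = y j) →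
      ∀ i j, ∑ k, A i k ≠ 0 → ∑ k, A j k ≠ 0 → y i = y j) :
    HyperbolicAtOne A := by
  classical
  intro x
  obtain ⟨d, hd⟩ : ∃ d : ι → ℝ, ∀ i, ∑ j, A i j = d i := ⟨_, fun _ => rfl⟩
  simp only [hd] at hA hconn ⊢
  have hd0 : ∀ i, 0 ≤ d i := fun i => hd i ▸ Finset.sum_nonneg fun j _ => h0 i j
  have hz : ∀ i j, d i = 0 → A i j = 0 := by
    intro i j hi
    rw [← hd, Finset.sum_eq_zero_iff_of_nonneg (fun j _ => h0 i j)] at hi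
    exact hi j (Finset.mem_univ _)
  set s := ∑ i, d i with hs
  have hsn : 0 ≤ s := Finset.sum_nonneg fun i _ => hd0 i
  rcases hsn.eq_or_lt with hs0 | hs0
  · rw [← hs0, zero_mul]; exact sq_nonneg _
  obtain ⟨q, hq⟩ : ∃ q : ι → ℝ, ∀ i, q i = Real.sqrt (d i) := ⟨_, fun _ => rfl⟩
  have hqq : ∀ i, q i * q i = d i := fun i => by rw [hq]; exact Real.mul_self_sqrt (hd0 i)
  have hq0 : ∀ i, d i = 0 → q i = 0 := fun i h => by rw [hq, h, Real.sqrt_zero]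
  have hq1 : ∀ i, d i ≠ 0 → q i ≠ 0 := fun i h h' => h (by rw [← hqq, h', mul_zero])
  -- `Q` is the difference of the two sides after conjugation by `D^(-1/2)`; evaluating it at `q i *
  -- x i` gives the claim. Rows with `d i = 0` vanish, since division by zero gives zero.
  set Q : Matrix ι ι ℝ := Matrix.of fun i j => q i * q j / s - A i j / (q i * q j) with hQ
  have hQh : Q.IsHermitian := by
    ext i j
    simp only [hQ, Matrix.conjTranspose_apply, Matrix.of_apply, star_trivial]
    rw [hsymm, mul_comm (q i)]
  have hpsd : Q.PosSemidef := by
    rw [hQh.posSemidef_iff_eigenvalues_nonneg]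
    intro k
    by_contra! hneg
    set l := hQh.eigenvalues k with hl
    change l < 0 at hneg
    obtain ⟨v, hv⟩ : ∃ v : ι → ℝ, v = ⇑(hQh.eigenvectorBasis k) := ⟨_, rfl⟩
    have hv0 : v ≠ 0 := by
      intro h
      have := hQh.eigenvectorBasis.orthonormal.ne_zero k
      exact this (by ext i; simpa [hv] using congrFun h i)
    have hev : ∀ i, ∑ j, Q i j * v j = l * v i := by
      intro i
      have := congrFun (hQh.mulVec_eigenvectorBasis k) i
      rw [← hv] at this
      simpa [Matrix.mulVec, dotProduct] using this
    obtain ⟨c, hc⟩ : ∃ c, c = ∑ j, q j * v j := ⟨_, rfl⟩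
    have hev' : ∀ i, l * v i = q i * c / s - ∑ j, A i j / (q i * q j) * v j := by
      intro i
      rw [← hev, hc, Finset.mul_sum, Finset.sum_div, ← Finset.sum_sub_distrib]
      refine Finset.sum_congr rfl fun j _ => ?_
      simp only [hQ, Matrix.of_apply]; ring
    have hvz : ∀ i, d i = 0 → v i = 0 := by
      intro i hi
      have h := hev' i
      simp [hq0 i hi] at h
      exact h.resolve_left hneg.ne
    have hy1 : ∀ i, v i = q i * (v i / q i) := by
      intro i
      rcases eq_or_ne (d i) 0 with h | h
      · simp [hvz i h]
      · have := hq1 i h; field_simp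
    -- In the coordinates `y = v / q`, an eigenvector of `Q` for `l < 0` becomes, once `c = 0` is
    -- known, an eigenvector of `D⁻¹ A` for `-l > 0`.
    have hAy : ∀ i, ∑ j, A i j * (v j / q j) = d i * c / s - l * (d i * (v i / q i)) := by
      intro i
      rcases eq_or_ne (d i) 0 with h | h
      · simp [h, hz i _ h]
      · have h1 := hev' i
        have h2 := hq1 i h
        have h3 : ∑ j, A i j / (q i * q j) * v j = (∑ j, A i j * (v j / q j)) / q i := by
          rw [Finset.sum_div]
          refine Finset.sum_congr rfl fun j _ => ?_
          rw [div_mul_eq_mul_div, mul_div_assoc', div_div, mul_comm (q j)]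
        rw [h3] at h1
        generalize ∑ j, A i j * (v j / q j) = z at h1 ⊢
        rw [← hqq]
        field_simp at h1 ⊢
        linarith
    have hcy : c = ∑ i, d i * (v i / q i) := by
      rw [hc]
      refine Finset.sum_congr rfl fun i _ => ?_
      rw [← hqq, mul_assoc, ← hy1]
    -- Summing `hAy` over `i` gives `c = c - l * c`.
    have hc0 : c = 0 := by
      have h1 : ∑ i, ∑ j, A i j * (v j / q j) = c := by
        rw [Finset.sum_comm, hcy]
        refine Finset.sum_congr rfl fun i _ => ?_
        rw [← Finset.sum_mul, ← hd]
        simp only [hsymm i]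
      simp only [hAy, Finset.sum_sub_distrib, ← Finset.mul_sum, ← hcy, ← Finset.sum_div,
        ← Finset.sum_mul, ← hs] at h1
      rw [mul_div_cancel_left₀ _ hs0.ne'] at h1
      have : l * c = 0 := by linarith
      exact (mul_eq_zero.1 this).resolve_left hneg.ne
    refine hv0 (funext fun i => ?_)
    rcases eq_or_ne (d i) 0 with h | h
    · exact hvz i h
    · rw [hy1 i, eq_zero_of_eigenvector hsymm h0 d hd hA hconn (fun i => v i / q i) (-l)
        (by linarith) (fun i => by rw [hAy, hc0]; ring) (by rw [← hcy, hc0]) i h, mul_zero]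
      rfl
  have h1 := hpsd.dotProduct_mulVec_nonneg (fun i => q i * x i)
  have h2 : star (fun i => q i * x i) ⬝ᵥ Q.mulVec (fun i => q i * x i) =
      (∑ i, d i * x i) ^ 2 / s - ∑ i, ∑ j, x i * A i j * x j := by
    rw [sq, Finset.sum_mul_sum, Finset.sum_div, ← Finset.sum_sub_distrib]
    refine Finset.sum_congr rfl fun i _ => ?_
    simp only [Matrix.mulVec, dotProduct, Finset.mul_sum, Pi.star_apply, star_trivial]
    rw [Finset.sum_div, ← Finset.sum_sub_distrib]
    refine Finset.sum_congr rfl fun j _ => ?_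
    simp only [hQ, Matrix.of_apply, ← hqq]
    rcases eq_or_ne (d i) 0 with h | h
    · simp [hq0 i h, hz i j h]
    rcases eq_or_ne (d j) 0 with h' | h'
    · simp [hq0 j h', hsymm i j, hz j i h']
    have := hq1 i h
    have := hq1 j h'
    field_simp
  rw [h2, sub_nonneg, le_div_iff₀ hs0] at h1
  linarith

/-- Zero-one matrices of complete multipartite graphs are hyperbolic at the all-ones vector. -/
theorem hyperbolicAtOne_multipartite {ι κ : Type*} [Fintype ι] [Fintype κ] [DecidableEq κ]
    (p : ι → Prop) [DecidablePred p] (f : ι → κ) :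
    HyperbolicAtOne fun i j => if p i ∧ p j ∧ f i ≠ f j then (1 : ℝ) else 0 := by
  by_cases hp : ∃ i, p i
  swap
  · push Not at hp
    intro x
    simp [hp]
  have hw : (∑ i, if p i then (1 : ℝ) else 0) ≠ 0 := by
    obtain ⟨i, hi⟩ := hp
    have h1 := Finset.single_le_sum (f := fun i => if p i then (1 : ℝ) else 0)
      (fun j _ => by positivity) (Finset.mem_univ i)
    simp only [hi, if_true] at h1
    linarith
  refine hyperbolicAtOne_of_nonpos (fun i j => if_congr (by tauto) rfl rfl)
    (fun i j => by positivity) _ hw fun y hy => ?_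
  set z : ι → ℝ := fun i => (if p i then (1 : ℝ) else 0) * y i with hz
  -- The form is the square of the total of `z` minus the squares of its class sums; orthogonality
  -- to the indicator of `p` kills the first term.
  have h1 : ∀ i j, y i * (if p i ∧ p j ∧ f i ≠ f j then (1 : ℝ) else 0) * y j =
      z i * z j - ∑ c, (if f i = c then z i else 0) * (if f j = c then z j else 0) := by
    intro i j
    have h2 : ∑ c, (if f i = c then z i else 0) * (if f j = c then z j else 0) =
        z i * (if f j = f i then z j else 0) := by
      simp only [mul_ite, ite_mul, zero_mul, mul_zero, Finset.sum_ite_eq, Finset.mem_univ, if_true]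
      exact if_congr eq_comm rfl rfl
    rw [h2]
    by_cases hi : p i <;> by_cases hj : p j <;> by_cases hf : f i = f j <;>
      simp [hz, hi, hj, hf, eq_comm]
  simp only [h1, Finset.sum_sub_distrib]
  rw [← Finset.sum_mul_sum, hy, zero_mul, zero_sub, neg_nonpos]
  have h3 : ∑ i, ∑ j, ∑ c, (if f i = c then z i else 0) * (if f j = c then z j else 0) =
      ∑ c, (∑ i, if f i = c then z i else 0) * ∑ j, if f j = c then z j else 0 := by
    simp only [Finset.sum_mul_sum]
    exact (Finset.sum_congr rfl fun i _ => Finset.sum_comm).trans Finset.sum_comm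
  rw [h3]
  exact Finset.sum_nonneg fun c _ => mul_self_nonneg _

/-! ### Counting bases through a given set -/

variable {n : ℕ}

/-- The number of bases containing `I`. -/
noncomputable def baseCount (M : Matroid (Fin n)) (I : Finset (Fin n)) : ℝ :=
  (((bases M).filter (I ⊆ ·)).card : ℝ)

/-- The Hessian at the all-ones vector of the bases generating polynomial of the contraction of
`M` by `I`: its entries count the bases containing `I` and two further distinct elements. -/
noncomputable def pairCount (M : Matroid (Fin n)) (I : Finset (Fin n)) (i j : Fin n) : ℝ :=
  if i ∈ I ∨ j ∈ I ∨ i = j then 0 else baseCount M (insert i (insert j I))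

theorem baseCount_nonneg (M : Matroid (Fin n)) (I : Finset (Fin n)) : 0 ≤ baseCount M I :=
  Nat.cast_nonneg _

theorem baseCount_empty (M : Matroid (Fin n)) : baseCount M ∅ = (bases M).card := by
  simp [baseCount]

theorem one_le_baseCount {M : Matroid (Fin n)} {I S : Finset (Fin n)} (hS : S ∈ bases M)
    (hIS : I ⊆ S) : 1 ≤ baseCount M I := by
  have h : 0 < ((bases M).filter (I ⊆ ·)).card :=
    Finset.card_pos.2 ⟨S, by simp [hS, hIS]⟩
  exact Nat.one_le_cast.2 h

theorem baseCount_ne_zero_iff {M : Matroid (Fin n)} {I : Finset (Fin n)} :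
    baseCount M I ≠ 0 ↔ M.Indep (I : Set (Fin n)) := by
  classical
  constructor
  · intro h
    have h' : ((bases M).filter (I ⊆ ·)).Nonempty := by
      rw [← Finset.card_ne_zero]
      exact fun h0 => h (by simp [baseCount, h0])
    obtain ⟨B, hB⟩ := h'
    rw [Finset.mem_filter, mem_bases] at hB
    exact hB.1.indep.subset (by exact_mod_cast hB.2)
  · intro h
    obtain ⟨B, hB, hIB⟩ := h.exists_isBase_superset
    have := one_le_baseCount (M := M) (S := B.toFinset) (I := I) (by simpa [mem_bases] using hB)
      (by intro x hx; simpa using hIB hx)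
    linarith

theorem baseCount_of_card {M : Matroid (Fin n)} {r : ℕ} (hr : ∀ B ∈ bases M, B.card = r)
    {I : Finset (Fin n)} (hI : I.card = r) (h : baseCount M I ≠ 0) : baseCount M I = 1 := by
  have h1 : ((bases M).filter (I ⊆ ·)).card ≤ 1 := by
    rw [Finset.card_le_one]
    intro a ha b hb
    rw [Finset.mem_filter] at ha hb
    rw [← Finset.eq_of_subset_of_card_le ha.2 (by rw [hr a ha.1, hI]),
      ← Finset.eq_of_subset_of_card_le hb.2 (by rw [hr b hb.1, hI])]
  refine le_antisymm (by unfold baseCount; exact_mod_cast h1) ?_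
  have h2 : ((bases M).filter (I ⊆ ·)).card ≠ 0 := fun h0 => h (by simp [baseCount, h0])
  unfold baseCount
  exact_mod_cast Nat.one_le_iff_ne_zero.2 h2

/-- Double counting: each base containing `J` has `r - |J|` elements outside `J`. -/
theorem sum_baseCount_insert {M : Matroid (Fin n)} {r : ℕ} (hr : ∀ B ∈ bases M, B.card = r)
    (J : Finset (Fin n)) :
    ∑ i, (if i ∈ J then 0 else baseCount M (insert i J)) = ((r : ℝ) - J.card) * baseCount M J := by
  have h1 : ∀ i, (if i ∈ J then 0 else baseCount M (insert i J)) =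
      ∑ B ∈ (bases M).filter (J ⊆ ·), if i ∈ B \ J then (1 : ℝ) else 0 := by
    intro i
    split_ifs with hi
    · simp [hi]
    · rw [Finset.sum_boole, Finset.filter_filter]
      unfold baseCount
      congr 2
      refine Finset.filter_congr fun B _ => ?_
      simp [Finset.insert_subset_iff, hi, and_comm]
  simp only [h1]
  rw [Finset.sum_comm]
  have h2 : ∀ B ∈ (bases M).filter (J ⊆ ·),
      (∑ i, if i ∈ B \ J then (1 : ℝ) else 0) = (r : ℝ) - J.card := by
    intro B hB
    rw [Finset.mem_filter] at hB
    rw [Finset.sum_boole, Finset.filter_mem_eq_inter, Finset.univ_inter,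
      Finset.cast_card_sdiff hB.2, hr B hB.1]
  rw [Finset.sum_congr rfl h2, Finset.sum_const, nsmul_eq_mul, mul_comm]
  rfl

theorem pairCount_symm (M : Matroid (Fin n)) (I : Finset (Fin n)) (i j : Fin n) :
    pairCount M I i j = pairCount M I j i := by
  unfold pairCount
  rw [Finset.insert_comm]
  exact if_congr (by rw [eq_comm (a := i)]; tauto) rfl rfl

theorem pairCount_nonneg (M : Matroid (Fin n)) (I : Finset (Fin n)) (i j : Fin n) :
    0 ≤ pairCount M I i j := by
  unfold pairCount
  split_ifs
  exacts [le_rfl, baseCount_nonneg _ _]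

theorem sum_pairCount {M : Matroid (Fin n)} {r : ℕ} (hr : ∀ B ∈ bases M, B.card = r)
    {I : Finset (Fin n)} {i : Fin n} (hi : i ∉ I) :
    ∑ j, pairCount M I i j = ((r : ℝ) - I.card - 1) * baseCount M (insert i I) := by
  have h := sum_baseCount_insert hr (insert i I)
  rw [Finset.card_insert_of_notMem hi] at h
  push_cast at h
  rw [sub_sub, ← h]
  refine Finset.sum_congr rfl fun j _ => ?_
  unfold pairCount
  rw [Finset.insert_comm]
  exact if_congr (by simp [hi, eq_comm, or_comm]) rfl rfl

theorem sum_pairCount_of_mem {M : Matroid (Fin n)} {I : Finset (Fin n)} {i : Fin n} (hi : i ∈ I) :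
    ∑ j, pairCount M I i j = 0 := by
  simp [pairCount, hi]

/-- Row sums one level up are proportional to row `i` at level `I`; this turns the inequality for `I
∪ {i}` into one about the `i`-th entry of `A x`. -/
theorem sum_pairCount_insert_right {M : Matroid (Fin n)} {r : ℕ}
    (hr : ∀ B ∈ bases M, B.card = r) {I : Finset (Fin n)} {i : Fin n} (hi : i ∉ I) (j : Fin n) :
    ∑ l, pairCount M (insert i I) j l = ((r : ℝ) - I.card - 2) * pairCount M I i j := by
  by_cases hj : j ∈ insert i I
  · rw [sum_pairCount_of_mem hj, pairCount, if_pos, mul_zero]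
    rw [Finset.mem_insert] at hj
    rcases hj with h | h
    · exact Or.inr (Or.inr h.symm)
    · exact Or.inr (Or.inl h)
  · rw [sum_pairCount hr hj, Finset.card_insert_of_notMem hi, pairCount, if_neg, Finset.insert_comm]
    · push_cast; ring
    · rw [Finset.mem_insert] at hj
      push Not at hj ⊢
      exact ⟨hi, hj.2, hj.1.symm⟩

/-- Each base through `I`, `j`, `l` is counted once for each of its remaining elements, so the
Hessians one level up sum to a multiple of the one at `I`. -/
theorem sum_pairCount_insert {M : Matroid (Fin n)} {r : ℕ}
    (hr : ∀ B ∈ bases M, B.card = r) (I : Finset (Fin n)) (j l : Fin n) :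
    ∑ i, (if i ∈ I then 0 else pairCount M (insert i I) j l) =
      ((r : ℝ) - I.card - 2) * pairCount M I j l := by
  by_cases h : j ∈ I ∨ l ∈ I ∨ j = l
  · have h' : ∀ i, pairCount M (insert i I) j l = 0 := fun i => by
      rw [pairCount, if_pos]
      simp only [Finset.mem_insert]
      tauto
    rw [pairCount, if_pos h, mul_zero]
    simp [h']
  · have h1 := sum_baseCount_insert hr (insert j (insert l I))
    push Not at h
    rw [Finset.card_insert_of_notMem (by simp [h]), Finset.card_insert_of_notMem h.2.1] at h1
    rw [pairCount, if_neg (by tauto)]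
    push_cast at h1
    rw [sub_sub, show (I.card : ℝ) + 2 = I.card + 1 + 1 by ring, ← h1]
    refine Finset.sum_congr rfl fun i _ => ?_
    unfold pairCount
    rw [Finset.insert_comm l i, Finset.insert_comm j i]
    simp only [Finset.mem_insert]
    by_cases hi : i ∈ I
    · simp [hi]
    · simp only [hi, if_false, or_false, h, eq_comm (a := i)]

/-! ### Parallel classes and hyperbolicity of the Hessians -/

/-- Being a nonloop of the contraction by `I`. -/
def Extends (M : Matroid (Fin n)) (I : Finset (Fin n)) (i : Fin n) : Prop :=
  i ∉ I ∧ M.Indep (insert i (I : Set (Fin n)))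

/-- Two nonloops of the contraction fail to extend `I` jointly exactly when they are parallel. The
support is thus complete multipartite, giving both the rank-two case and connectedness. -/
theorem pairCount_ne_zero_iff {M : Matroid (Fin n)} {I : Finset (Fin n)} {i j : Fin n} :
    pairCount M I i j ≠ 0 ↔ Extends M I i ∧ Extends M I j ∧
      M.closure (insert i (I : Set (Fin n))) ≠ M.closure (insert j (I : Set (Fin n))) := by
  unfold pairCount Extends
  split_ifs with h
  · simp only [ne_eq, not_true_eq_false, false_iff]
    rintro ⟨hi, hj, hne⟩
    rcases h with h | h | h
    · exact hi.1 h
    · exact hj.1 h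
    · exact hne (by rw [h])
  · rw [baseCount_ne_zero_iff]
    push Not at h
    push_cast
    constructor
    · intro hI
      have h1 : M.Indep (insert i (I : Set (Fin n))) :=
        hI.subset (Set.insert_subset_insert (Set.subset_insert _ _))
      have h2 : M.Indep (insert j (I : Set (Fin n))) := hI.subset (Set.subset_insert _ _)
      refine ⟨⟨h.1, h1⟩, ⟨h.2.1, h2⟩, fun heq => ?_⟩
      rw [h2.insert_indep_iff_of_notMem (by simp [h])] at hI
      exact hI.2 (heq ▸ M.mem_closure_of_mem (Set.mem_insert _ _) h1.subset_ground)
    · rintro ⟨hi, hj, hne⟩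
      rw [hj.2.insert_indep_iff_of_notMem (by simp [h])]
      refine ⟨hi.2.subset_ground (Set.mem_insert _ _), fun hc => hne ?_⟩
      refine Matroid.closure_insert_congr ⟨hc, fun hc' => ?_⟩
      have hI : M.Indep (I : Set (Fin n)) := hi.2.subset (Set.subset_insert _ _)
      exact ((hI.insert_indep_iff_of_notMem hi.1).1 hi.2).2 hc'

theorem exists_pairCount_ne_zero {M : Matroid (Fin n)} {I : Finset (Fin n)} {i : Fin n}
    (h : ∑ j, pairCount M I i j ≠ 0) : ∃ j, pairCount M I i j ≠ 0 := by
  obtain ⟨j, -, hj⟩ := Finset.exists_ne_zero_of_sum_ne_zero h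
  exact ⟨j, hj⟩

/-- The matrices `pairCount` satisfy the reversed Cauchy–Schwarz inequality against the all-ones
vector. -/
theorem hyperbolicAtOne_pairCount {M : Matroid (Fin n)} {r : ℕ} (hr : ∀ B ∈ bases M, B.card = r)
    (k : ℕ) : ∀ I : Finset (Fin n), I.card + k + 2 = r → HyperbolicAtOne (pairCount M I) := by
  classical
  induction k with
  | zero =>
    intro I hI
    convert hyperbolicAtOne_multipartite (Extends M I)
      (fun i => M.closure (insert i (I : Set (Fin n)))) using 1
    funext i j
    by_cases h : pairCount M I i j ≠ 0
    · rw [if_pos (pairCount_ne_zero_iff.1 h)]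
      unfold pairCount at h ⊢
      split_ifs at h ⊢ with h'
      · exact absurd rfl h
      · push Not at h'
        refine baseCount_of_card hr ?_ h
        rw [Finset.card_insert_of_notMem (by simp [h']), Finset.card_insert_of_notMem h'.2.1]
        omega
    · rw [if_neg (mt pairCount_ne_zero_iff.2 h)]
      simpa using h
  | succ k ih =>
    intro I hI
    have hk : (r : ℝ) - I.card - 2 = k + 1 := by
      rw [← hI]; push_cast; ring
    have hk0 : (0 : ℝ) < k + 1 := by positivity
    refine hyperbolicAtOne_of_le (pairCount_symm M I) (pairCount_nonneg M I) (fun x => ?_) ?_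
    -- The induction hypothesis reads `(k + 1) dᵢ qᵢ(x) ≤ ((k + 1) (A x)ᵢ)²`; divide by `(k + 1)
    -- dᵢ`. If `dᵢ = 0`, both sides vanish.
    · have hlocal : ∀ i, (if i ∈ I then 0 else
          ∑ j, ∑ l, x j * pairCount M (insert i I) j l * x l) ≤
          (k + 1) * ((∑ j, pairCount M I i j * x j) ^ 2 / ∑ j, pairCount M I i j) := by
        intro i
        have hd0 : 0 ≤ ∑ j, pairCount M I i j := Finset.sum_nonneg fun j _ => pairCount_nonneg _ _ _ _
        split_ifs with hi
        · positivity
        have h := ih (insert i I) (by rw [Finset.card_insert_of_notMem hi]; omega) x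
        have e1 : ∑ j, ((k : ℝ) + 1) * pairCount M I i j * x j =
            (k + 1) * ∑ j, pairCount M I i j * x j := by
          rw [Finset.mul_sum]
          exact Finset.sum_congr rfl fun j _ => mul_assoc _ _ _
        simp only [sum_pairCount_insert_right hr hi, hk] at h
        rw [e1, ← Finset.mul_sum, mul_assoc] at h
        rcases hd0.eq_or_lt with h0 | h0
        · rw [← h0, div_zero, mul_zero]
          refine le_of_eq (Finset.sum_eq_zero fun j _ => Finset.sum_eq_zero fun l _ => ?_)
          have h1 : ∑ l, pairCount M (insert i I) j l = 0 := by
            rw [eq_comm, Finset.sum_eq_zero_iff_of_nonneg (fun j _ => pairCount_nonneg _ _ _ _)] at h0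
            rw [sum_pairCount_insert_right hr hi, h0 j (Finset.mem_univ _), mul_zero]
          rw [Finset.sum_eq_zero_iff_of_nonneg (fun j _ => pairCount_nonneg _ _ _ _)] at h1
          rw [h1 l (Finset.mem_univ _), mul_zero, zero_mul]
        · rw [← mul_div_assoc, le_div_iff₀ h0]
          rw [mul_pow, sq ((k : ℝ) + 1), mul_assoc] at h
          have h' := le_of_mul_le_mul_left h hk0
          linarith
      have hsum : ((k : ℝ) + 1) * ∑ j, ∑ l, x j * pairCount M I j l * x l =
          ∑ i, if i ∈ I then 0 else ∑ j, ∑ l, x j * pairCount M (insert i I) j l * x l := by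
        have h1 : ∀ i, (if i ∈ I then 0 else
            ∑ j, ∑ l, x j * pairCount M (insert i I) j l * x l) =
            ∑ j, ∑ l, x j * (if i ∈ I then 0 else pairCount M (insert i I) j l) * x l := by
          intro i
          split_ifs <;> simp
        simp only [h1]
        symm
        rw [Finset.sum_comm, Finset.mul_sum]
        refine Finset.sum_congr rfl fun j _ => ?_
        rw [Finset.sum_comm, Finset.mul_sum]
        refine Finset.sum_congr rfl fun l _ => ?_
        rw [← Finset.sum_mul, ← Finset.mul_sum, sum_pairCount_insert hr, hk]
        ring
      refine le_of_mul_le_mul_left ?_ hk0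
      rw [hsum, Finset.mul_sum]
      exact Finset.sum_le_sum fun i _ => hlocal i
    -- Nonparallel nonloops are adjacent; parallel ones share every neighbour.
    · intro y hy i j hi hj
      obtain ⟨a, ha⟩ := exists_pairCount_ne_zero hi
      obtain ⟨b, hb⟩ := exists_pairCount_ne_zero hj
      have ha' := pairCount_ne_zero_iff.1 ha
      have hb' := pairCount_ne_zero_iff.1 hb
      by_cases hij : M.closure (insert i (I : Set (Fin n))) = M.closure (insert j (I : Set (Fin n)))
      · rw [hy i a ha, hy j a (pairCount_ne_zero_iff.2 ⟨hb'.1, ha'.2.1, hij ▸ ha'.2.2⟩)]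
      · exact hy i j (pairCount_ne_zero_iff.2 ⟨ha'.1, hb'.1, hij⟩)

/-! ### From pair correlations to a bound along each base -/

/-- The local form of the reversed Cauchy–Schwarz inequality for the indicator vector of `S \ I`,
normalised by the base counts. -/
theorem sum_baseCount_insert_insert_le {M : Matroid (Fin n)} {r : ℕ}
    (hr : ∀ B ∈ bases M, B.card = r) {S I : Finset (Fin n)} (hS : S ∈ bases M) (hIS : I ⊆ S)
    {k : ℕ} (hk : I.card + k + 2 = r) :
    ∑ i ∈ S \ I, ∑ j ∈ (S \ I).erase i, baseCount M (insert j (insert i I)) * baseCount M I /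
      (baseCount M (insert i I) * baseCount M (insert j I)) ≤ (k + 1) * (k + 2) := by
  classical
  have hrk : (r : ℝ) - I.card = k + 2 := by rw [← hk]; push_cast; ring
  have hpos : ∀ i ∈ S \ I, 0 < baseCount M (insert i I) := fun i hi => by
    rw [Finset.mem_sdiff] at hi
    linarith [one_le_baseCount hS (Finset.insert_subset hi.1 hIS)]
  have hcard : ((S \ I).card : ℝ) = k + 2 := by rw [Finset.cast_card_sdiff hIS, hr S hS, hrk]
  -- These weights make every `i ∈ S \ I` contribute `k + 1` to the row-sum form. The resulting
  -- bound is the number of ordered pairs in `S \ I`, so the correlation ratios average at most 1.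
  set x : Fin n → ℝ := fun i => if i ∈ S \ I then (baseCount M (insert i I))⁻¹ else 0 with hx
  have h := hyperbolicAtOne_pairCount hr k I hk x
  have hrow : ∀ i, ∑ j, pairCount M I i j =
      (k + 1) * (if i ∈ I then 0 else baseCount M (insert i I)) := by
    intro i
    split_ifs with hi
    · rw [sum_pairCount_of_mem hi, mul_zero]
    · rw [sum_pairCount hr hi, hrk]; ring
  have h1 : ∑ i, ∑ j, pairCount M I i j = (k + 1) * ((k + 2) * baseCount M I) := by
    simp only [hrow, ← Finset.mul_sum]
    rw [sum_baseCount_insert hr, hrk]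
  have h2 : ∑ i, (∑ j, pairCount M I i j) * x i = (k + 1) * (k + 2) := by
    rw [← hcard, Finset.cast_card, Finset.mul_sum, ← Finset.sum_subset (Finset.subset_univ (S \ I))]
    · refine Finset.sum_congr rfl fun i hi => ?_
      have h3 := (Finset.mem_sdiff.1 hi).2
      have := (hpos i hi).ne'
      simp only [hx]
      rw [hrow, if_neg h3, if_pos hi]
      field_simp
    · intro i _ hi
      simp only [hx]
      rw [if_neg hi, mul_zero]
  have h3 : ∑ i, ∑ j, x i * pairCount M I i j * x j = ∑ i ∈ S \ I, ∑ j ∈ (S \ I).erase i,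
      baseCount M (insert j (insert i I)) /
        (baseCount M (insert i I) * baseCount M (insert j I)) := by
    rw [← Finset.sum_subset (Finset.subset_univ (S \ I))]
    · refine Finset.sum_congr rfl fun i hi => ?_
      rw [← Finset.sum_subset (Finset.subset_univ ((S \ I).erase i))]
      · refine Finset.sum_congr rfl fun j hj => ?_
        have hj' := Finset.mem_of_mem_erase hj
        simp only [hx]
        rw [if_pos hi, if_pos hj', pairCount, if_neg, Finset.insert_comm]
        · ring
        · push Not
          exact ⟨(Finset.mem_sdiff.1 hi).2, (Finset.mem_sdiff.1 hj').2,
            (Finset.ne_of_mem_erase hj).symm⟩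
      · intro j _ hj
        by_cases hij : i = j
        · simp [hij, pairCount]
        · have : j ∉ S \ I := fun h => hj (Finset.mem_erase.2 ⟨Ne.symm hij, h⟩)
          simp only [hx]
          rw [if_neg this, mul_zero]
    · intro i _ hi
      refine Finset.sum_eq_zero fun j _ => ?_
      simp only [hx]
      rw [if_neg hi, zero_mul, zero_mul]
  have h4 : ∑ i ∈ S \ I, ∑ j ∈ (S \ I).erase i, baseCount M (insert j (insert i I)) *
      baseCount M I / (baseCount M (insert i I) * baseCount M (insert j I)) =
      baseCount M I * ∑ i, ∑ j, x i * pairCount M I i j * x j := by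
    rw [h3]
    simp only [Finset.mul_sum]
    exact Finset.sum_congr rfl fun i _ => Finset.sum_congr rfl fun j _ => by ring
  rw [h1, h2] at h
  rw [h4]
  have h5 : (0 : ℝ) < (k + 1) * (k + 2) := by positivity
  refine le_of_mul_le_mul_left ?_ h5
  linarith

/-- Iterated local inequalities along a base: for a base `S ⊇ I` of size `|I| + k`, the product
of the counts of bases containing `I ∪ {i}`, `i ∈ S \ I`, is at least the `(k - 1)`-st power of
the count of bases containing `I`. -/
theorem mul_log_baseCount_le {M : Matroid (Fin n)} {r : ℕ} (hr : ∀ B ∈ bases M, B.card = r)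
    {S : Finset (Fin n)} (hS : S ∈ bases M) (k : ℕ) : ∀ I ⊆ S, I.card + k = r →
    ((k : ℝ) - 1) * Real.log (baseCount M I) ≤
      ∑ i ∈ S \ I, Real.log (baseCount M (insert i I)) := by
  classical
  have hlog : ∀ J ⊆ S, 0 ≤ Real.log (baseCount M J) := fun J hJ =>
    Real.log_nonneg (one_le_baseCount hS hJ)
  induction k with
  | zero =>
    intro I hI _
    have h1 := hlog I hI
    have h2 : 0 ≤ ∑ i ∈ S \ I, Real.log (baseCount M (insert i I)) :=
      Finset.sum_nonneg fun i hi =>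
        hlog _ (Finset.insert_subset (Finset.mem_sdiff.1 hi).1 hI)
    push_cast
    linarith
  | succ k ih =>
    intro I hI hcard
    have hins : ∀ i ∈ S \ I, insert i I ⊆ S := fun i hi =>
      Finset.insert_subset (Finset.mem_sdiff.1 hi).1 hI
    rcases k with _ | k
    · have h2 : 0 ≤ ∑ i ∈ S \ I, Real.log (baseCount M (insert i I)) :=
        Finset.sum_nonneg fun i hi => hlog _ (hins i hi)
      simpa using h2
    set T := S \ I with hT
    set a := Real.log (baseCount M I) with ha
    set b : Fin n → ℝ := fun i => Real.log (baseCount M (insert i I)) with hb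
    set c : Fin n → Fin n → ℝ := fun i j => Real.log (baseCount M (insert j (insert i I))) with hc
    have hTc : (T.card : ℝ) = k + 2 := by
      rw [hT, Finset.cast_card_sdiff hI, hr S hS, ← hcard]; push_cast; ring
    have hEc : ∀ i ∈ T, ((T.erase i).card : ℝ) = k + 1 := fun i hi => by
      rw [Finset.card_erase_of_mem hi, Nat.cast_pred (Finset.card_pos.2 ⟨i, hi⟩), hTc]; ring
    have h1 : ∀ i ∈ T, (k : ℝ) * b i ≤ ∑ j ∈ T.erase i, c i j := by
      intro i hi
      have h := ih (insert i I) (hins i hi) (by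
        rw [Finset.card_insert_of_notMem (Finset.mem_sdiff.1 hi).2]; omega)
      have e : S \ insert i I = T.erase i := by
        ext j; simp [hT]; tauto
      rw [e] at h
      push_cast at h
      simpa using h
    have h2 : ∀ i ∈ T, ∀ j ∈ T.erase i, c i j + a - b i - b j ≤
        baseCount M (insert j (insert i I)) * baseCount M I /
          (baseCount M (insert i I) * baseCount M (insert j I)) - 1 := by
      intro i hi j hj
      have hj' := Finset.mem_of_mem_erase hj
      have p1 : 0 < baseCount M (insert j (insert i I)) :=
        zero_lt_one.trans_le (one_le_baseCount hS
          (Finset.insert_subset (Finset.mem_sdiff.1 hj').1 (hins i hi)))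
      have p2 : 0 < baseCount M I := zero_lt_one.trans_le (one_le_baseCount hS hI)
      have p3 : 0 < baseCount M (insert i I) :=
        zero_lt_one.trans_le (one_le_baseCount hS (hins i hi))
      have p4 : 0 < baseCount M (insert j I) :=
        zero_lt_one.trans_le (one_le_baseCount hS (hins j hj'))
      refine le_trans (le_of_eq ?_) (Real.log_le_sub_one_of_pos (by positivity))
      rw [Real.log_div (by positivity) (by positivity), Real.log_mul p1.ne' p2.ne',
        Real.log_mul p3.ne' p4.ne']
      ring
    -- By `log t ≤ t - 1`, ratios of average at most 1 have logarithms of nonpositive sum.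
    have h3 : ∑ i ∈ T, ∑ j ∈ T.erase i, (c i j + a - b i - b j) ≤ 0 := by
      refine (Finset.sum_le_sum fun i hi => Finset.sum_le_sum (h2 i hi)).trans ?_
      have h4 := sum_baseCount_insert_insert_le hr hS hI (k := k) (by omega)
      simp only [Finset.sum_sub_distrib, Finset.sum_const, nsmul_eq_mul, mul_one]
      rw [Finset.sum_congr rfl hEc, Finset.sum_const, nsmul_eq_mul, hTc]
      linarith
    have h4 : ∀ i ∈ T, ∑ j ∈ T.erase i, (c i j + a - b i - b j) =
        (∑ j ∈ T.erase i, c i j) + (k + 1) * a - k * b i - ∑ j ∈ T, b j := by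
      intro i hi
      rw [← Finset.add_sum_erase T b hi]
      simp only [Finset.sum_sub_distrib, Finset.sum_add_distrib, Finset.sum_const, nsmul_eq_mul,
        hEc i hi]
      ring
    rw [Finset.sum_congr rfl h4] at h3
    -- With `k ∑ b ≤ ∑∑ c` from induction, `h3` becomes `(k + 2)(k + 1) a ≤ (k + 2) ∑ b`.
    have h5 := Finset.sum_le_sum h1
    simp only [Finset.sum_sub_distrib, Finset.sum_add_distrib, Finset.sum_const, nsmul_eq_mul,
      ← Finset.mul_sum, hTc] at h3 h5
    have h6 : (0 : ℝ) < k + 2 := by positivity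
    refine le_of_mul_le_mul_left ?_ h6
    push_cast
    linarith

/-! ### Entropy and marginals of the uniform distribution -/

theorem uniformBases_toReal (M : Matroid (Fin n)) (S : Finset (Fin n)) :
    (uniformBases M S).toReal = if S ∈ bases M then ((bases M).card : ℝ)⁻¹ else 0 := by
  unfold uniformBases
  rw [PMF.uniformOfFinset_apply]
  split_ifs <;> simp

theorem card_bases_pos (M : Matroid (Fin n)) : (0 : ℝ) < (bases M).card :=
  Nat.cast_pos.2 (Finset.card_pos.2 (bases_nonempty M))

theorem entropy_uniformBases (M : Matroid (Fin n)) :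
    entropy (uniformBases M) = Real.log (bases M).card := by
  have h := (card_bases_pos M).ne'
  unfold entropy
  simp only [uniformBases_toReal, ite_mul, zero_mul]
  rw [Finset.sum_ite_mem, Finset.univ_inter]
  have h1 : ∀ S ∈ bases M, ((bases M).card : ℝ)⁻¹ *
      Real.log (1 / if S ∈ bases M then ((bases M).card : ℝ)⁻¹ else 0) =
      ((bases M).card : ℝ)⁻¹ * Real.log (bases M).card := by
    intro S hS
    rw [if_pos hS, one_div, inv_inv]
  rw [Finset.sum_congr rfl h1, Finset.sum_const, nsmul_eq_mul, ← mul_assoc, mul_inv_cancel₀ h,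
    one_mul]

theorem marginal_uniformBases (M : Matroid (Fin n)) (i : Fin n) :
    marginal (uniformBases M) i = ((bases M).filter (i ∈ ·)).card / (bases M).card := by
  unfold marginal
  simp only [uniformBases_toReal]
  rw [← Finset.sum_filter, Finset.sum_const, nsmul_eq_mul, div_eq_mul_inv, Finset.filter_filter]
  congr 3
  ext S
  simp [and_comm]

theorem marginal_eq_baseCount (M : Matroid (Fin n)) (i : Fin n) :
    marginal (uniformBases M) i = baseCount M {i} / (bases M).card := by
  rw [marginal_uniformBases]
  simp [baseCount]

theorem marginal_nonneg (M : Matroid (Fin n)) (i : Fin n) : 0 ≤ marginal (uniformBases M) i := by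
  rw [marginal_uniformBases]
  positivity

theorem marginal_pos {M : Matroid (Fin n)} {S : Finset (Fin n)} (hS : S ∈ bases M) {i : Fin n}
    (hi : i ∈ S) : 0 < marginal (uniformBases M) i := by
  rw [marginal_eq_baseCount]
  have := one_le_baseCount hS (Finset.singleton_subset_iff.2 hi)
  have := card_bases_pos M
  positivity

theorem one_sub_marginal (M : Matroid (Fin n)) (i : Fin n) :
    1 - marginal (uniformBases M) i = ((bases M).filter (i ∉ ·)).card / (bases M).card := by
  have h := (card_bases_pos M).ne'
  have h1 := Finset.card_filter_add_card_filter_not (s := bases M) (i ∈ ·)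
  have h2 : (((bases M).filter (i ∈ ·)).card : ℝ) + ((bases M).filter (i ∉ ·)).card =
      (bases M).card := by exact_mod_cast h1
  rw [marginal_uniformBases, eq_div_iff h, sub_mul, div_mul_cancel₀ _ h, ← h2]
  ring

theorem marginal_le_one (M : Matroid (Fin n)) (i : Fin n) : marginal (uniformBases M) i ≤ 1 := by
  rw [← sub_nonneg, one_sub_marginal]
  positivity

theorem marginal_lt_one {M : Matroid (Fin n)} {S : Finset (Fin n)} (hS : S ∈ bases M) {i : Fin n}
    (hi : i ∉ S) : marginal (uniformBases M) i < 1 := by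
  rw [← sub_pos, one_sub_marginal]
  have h : 0 < ((bases M).filter (i ∉ ·)).card := Finset.card_pos.2 ⟨S, by simp [hS, hi]⟩
  have := card_bases_pos M
  positivity

theorem sum_bases_sum_mem (M : Matroid (Fin n)) (g : Fin n → ℝ) :
    ∑ S ∈ bases M, ∑ i ∈ S, g i = (bases M).card * ∑ i, marginal (uniformBases M) i * g i := by
  have h := (card_bases_pos M).ne'
  rw [Finset.sum_comm' (t' := Finset.univ) (s' := fun i => (bases M).filter (i ∈ ·))
    (by simp), Finset.mul_sum]
  refine Finset.sum_congr rfl fun i _ => ?_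
  rw [Finset.sum_const, nsmul_eq_mul, marginal_uniformBases]
  field_simp

theorem sum_bases_sum_compl (M : Matroid (Fin n)) (g : Fin n → ℝ) :
    ∑ S ∈ bases M, ∑ i ∈ Sᶜ, g i =
      (bases M).card * ∑ i, (1 - marginal (uniformBases M) i) * g i := by
  have h := (card_bases_pos M).ne'
  rw [Finset.sum_comm' (t' := Finset.univ) (s' := fun i => (bases M).filter (i ∉ ·))
    (by simp), Finset.mul_sum]
  refine Finset.sum_congr rfl fun i _ => ?_
  rw [Finset.sum_const, nsmul_eq_mul, one_sub_marginal]
  field_simp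

theorem card_eq_of_mem_bases {M : Matroid (Fin n)} {S T : Finset (Fin n)} (hS : S ∈ bases M)
    (hT : T ∈ bases M) : S.card = T.card := by
  rw [mem_bases] at hS hT
  have h := hS.encard_eq_encard_of_isBase hT
  rw [Set.encard_coe_eq_coe_finsetCard, Set.encard_coe_eq_coe_finsetCard] at h
  exact_mod_cast h

/-- The entropy of the uniform distribution on the bases is at least `∑ μᵢ log (1 / μᵢ)`. -/
theorem sum_marginal_mul_log_le (M : Matroid (Fin n)) :
    ∑ i, marginal (uniformBases M) i * Real.log (marginal (uniformBases M) i)⁻¹ ≤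
      Real.log (bases M).card := by
  have hb := card_bases_pos M
  refine le_of_mul_le_mul_left ?_ hb
  rw [← sum_bases_sum_mem, ← nsmul_eq_mul, ← Finset.sum_const]
  refine Finset.sum_le_sum fun S hS => ?_
  -- Taking `I = ∅`, each base `S` satisfies `∑_{i ∈ S} log (1/μᵢ) ≤ log |B_M|`, which is then
  -- averaged over `S`.
  have h := mul_log_baseCount_le (r := S.card) (fun B hB => card_eq_of_mem_bases hB hS) hS S.card ∅
    (Finset.empty_subset _) (by simp)
  rw [baseCount_empty, Finset.sdiff_empty] at h
  have h1 : ∀ i ∈ S, Real.log (marginal (uniformBases M) i)⁻¹ =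
      Real.log (bases M).card - Real.log (baseCount M (insert i ∅)) := by
    intro i hi
    have := one_le_baseCount hS (Finset.singleton_subset_iff.2 hi)
    rw [marginal_eq_baseCount, inv_div, Real.log_div hb.ne' (by linarith)]
    rfl
  rw [Finset.sum_congr rfl h1, Finset.sum_sub_distrib, Finset.sum_const, nsmul_eq_mul]
  linarith

/-! ### Duality -/

theorem compl_mem_bases_dual {M : Matroid (Fin n)} (hE : M.E = Set.univ) {S : Finset (Fin n)} :
    Sᶜ ∈ bases M✶ ↔ S ∈ bases M := by
  rw [mem_bases, mem_bases, Matroid.dual_isBase_iff', hE]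
  simp

theorem card_filter_bases_dual {M : Matroid (Fin n)} (hE : M.E = Set.univ)
    (p q : Finset (Fin n) → Prop) [DecidablePred p] [DecidablePred q] (hpq : ∀ S, p S ↔ q Sᶜ) :
    ((bases M).filter p).card = ((bases M✶).filter q).card := by
  refine Finset.card_bij (fun S _ => Sᶜ) (fun S hS => ?_) (fun S _ T _ h => compl_injective h)
    fun S hS => ⟨Sᶜ, ?_, compl_compl S⟩
  · rw [Finset.mem_filter] at hS ⊢
    exact ⟨(compl_mem_bases_dual hE).2 hS.1, (hpq S).1 hS.2⟩
  · rw [Finset.mem_filter] at hS ⊢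
    rw [hpq, ← compl_mem_bases_dual hE, compl_compl]
    exact hS

theorem card_bases_dual {M : Matroid (Fin n)} (hE : M.E = Set.univ) :
    (bases M✶).card = (bases M).card := by
  simpa using (card_filter_bases_dual hE (fun _ => True) (fun _ => True) (by simp)).symm

theorem marginal_dual {M : Matroid (Fin n)} (hE : M.E = Set.univ) (i : Fin n) :
    marginal (uniformBases M✶) i = 1 - marginal (uniformBases M) i := by
  rw [one_sub_marginal, marginal_uniformBases, card_bases_dual hE,
    card_filter_bases_dual hE (i ∉ ·) (i ∈ ·) (by simp)]

/-! ### Upper bound and final estimates -/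

/-- Subadditivity of entropy for the uniform distribution on the bases. -/
theorem log_card_bases_le (M : Matroid (Fin n)) :
    Real.log (bases M).card ≤ ∑ i, Real.binEntropy (marginal (uniformBases M) i) := by
  have hb := card_bases_pos M
  set m : Fin n → ℝ := fun i => marginal (uniformBases M) i with hm
  -- The law of a random set containing each `i` independently with probability `m i`.
  set w : Finset (Fin n) → ℝ := fun S => (∏ i ∈ S, m i) * ∏ i ∈ Sᶜ, (1 - m i) with hw
  have hw0 : ∀ S, 0 ≤ w S := fun S => mul_nonneg (Finset.prod_nonneg fun i _ => marginal_nonneg M i)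
    (Finset.prod_nonneg fun i _ => sub_nonneg.2 (marginal_le_one M i))
  have hw1 : ∑ S ∈ bases M, w S ≤ 1 := by
    have h1 : ∑ S, w S = 1 := by
      have h2 := Finset.prod_add m (fun i => 1 - m i) Finset.univ
      simp only [add_sub_cancel, Finset.prod_const_one, Finset.powerset_univ] at h2
      rw [h2]
      rfl
    rw [← h1]
    exact Finset.sum_le_sum_of_subset_of_nonneg (Finset.subset_univ _) fun S _ _ => hw0 S
  -- Gibbs' inequality termwise: `log t ≤ t - 1` at `t = |B_M| w(S)`, the likelihood ratio of `w` to
  -- the uniform law.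
  have h1 : ∀ S ∈ bases M, Real.log (bases M).card + ∑ i ∈ S, Real.log (m i) +
      ∑ i ∈ Sᶜ, Real.log (1 - m i) ≤ (bases M).card * w S - 1 := by
    intro S hS
    have p1 : ∀ i ∈ S, 0 < m i := fun i hi => marginal_pos hS hi
    have p2 : ∀ i ∈ Sᶜ, 0 < 1 - m i := fun i hi =>
      sub_pos.2 (marginal_lt_one hS (Finset.mem_compl.1 hi))
    have q1 := Finset.prod_pos p1
    have q2 := Finset.prod_pos p2
    refine le_trans (le_of_eq ?_) (Real.log_le_sub_one_of_pos (mul_pos hb (mul_pos q1 q2)))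
    rw [Real.log_mul hb.ne' (mul_pos q1 q2).ne', Real.log_mul q1.ne' q2.ne',
      Real.log_prod fun i hi => (p1 i hi).ne', Real.log_prod fun i hi => (p2 i hi).ne']
    ring
  have h2 := Finset.sum_le_sum h1
  simp only [Finset.sum_add_distrib, Finset.sum_sub_distrib, Finset.sum_const, nsmul_eq_mul,
    mul_one, ← Finset.mul_sum] at h2
  rw [sum_bases_sum_mem, sum_bases_sum_compl] at h2
  have h3 : ∑ i, Real.binEntropy (m i) =
      -(∑ i, m i * Real.log (m i)) - ∑ i, (1 - m i) * Real.log (1 - m i) := by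
    rw [← Finset.sum_neg_distrib, ← Finset.sum_sub_distrib]
    refine Finset.sum_congr rfl fun i _ => ?_
    rw [Real.binEntropy, Real.log_inv, Real.log_inv]
    ring
  rw [h3]
  refine le_of_mul_le_mul_left ?_ hb
  have h4 : ((bases M).card : ℝ) * ∑ S ∈ bases M, w S ≤ (bases M).card * 1 :=
    mul_le_mul_of_nonneg_left hw1 hb.le
  linarith

theorem sum_marginal {M : Matroid (Fin n)} {r : ℕ} (hr : M.eRank = (r : ℕ∞)) :
    ∑ i, marginal (uniformBases M) i = r := by
  have hb := card_bases_pos M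
  have h := sum_bases_sum_mem M fun _ => 1
  have h1 : ∀ S ∈ bases M, ∑ _i ∈ S, (1 : ℝ) = r := by
    intro S hS
    rw [mem_bases] at hS
    have h2 := hS.encard_eq_eRank
    rw [hr, Set.encard_coe_eq_coe_finsetCard] at h2
    have h3 : S.card = r := by exact_mod_cast h2
    simp [h3]
  rw [Finset.sum_congr rfl h1, Finset.sum_const, nsmul_eq_mul] at h
  simp only [mul_one] at h
  exact (mul_left_cancel₀ hb.ne' h).symm

/-- This is `log t ≤ t - 1` at `t = 1/(1 - p)`; summed over the marginals it yields the additive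
error `r`. -/
theorem one_sub_mul_log_inv_le {p : ℝ} (hp : p ≤ 1) : (1 - p) * Real.log (1 - p)⁻¹ ≤ p := by
  rcases hp.eq_or_lt with rfl | hp
  · simp
  · have h : 0 < 1 - p := sub_pos.2 hp
    have h1 := mul_le_mul_of_nonneg_left (Real.log_le_sub_one_of_pos (inv_pos.2 h)) h.le
    rw [mul_sub, mul_inv_cancel₀ h.ne'] at h1
    linarith

end MatroidEntropy

theorem mainTheorem8 (n r : ℕ) (M : Matroid (Fin n)) (hE : M.E = Set.univ)
    (hr : M.eRank = (r : ℕ∞)) :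
    MatroidEntropy.entropy (MatroidEntropy.uniformBases M)
        = Real.log ((MatroidEntropy.bases M).card : ℝ) ∧
      max ((1 / 2 : ℝ) * ∑ i : Fin n,
              Real.binEntropy (MatroidEntropy.marginal (MatroidEntropy.uniformBases M) i))
          ((∑ i : Fin n,
              Real.binEntropy (MatroidEntropy.marginal (MatroidEntropy.uniformBases M) i)) - (r : ℝ))
        ≤ MatroidEntropy.entropy (MatroidEntropy.uniformBases M) ∧
      MatroidEntropy.entropy (MatroidEntropy.uniformBases M)
        ≤ ∑ i : Fin n,
            Real.binEntropy (MatroidEntropy.marginal (MatroidEntropy.uniformBases M) i) := by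
  refine ⟨MatroidEntropy.entropy_uniformBases M, ?_, ?_⟩
  · have h1 := MatroidEntropy.sum_marginal_mul_log_le M
    have h2 := MatroidEntropy.sum_marginal_mul_log_le M✶
    rw [MatroidEntropy.card_bases_dual hE] at h2
    simp only [MatroidEntropy.marginal_dual hE] at h2
    have h3 : ∑ i, (1 - MatroidEntropy.marginal (MatroidEntropy.uniformBases M) i) *
        Real.log (1 - MatroidEntropy.marginal (MatroidEntropy.uniformBases M) i)⁻¹ ≤ r := by
      rw [← MatroidEntropy.sum_marginal hr]
      exact Finset.sum_le_sum fun i _ =>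
        MatroidEntropy.one_sub_mul_log_inv_le (MatroidEntropy.marginal_le_one M i)
    rw [MatroidEntropy.entropy_uniformBases]
    simp only [Real.binEntropy, Finset.sum_add_distrib]
    exact max_le (by linarith) (by linarith)
  · rw [MatroidEntropy.entropy_uniformBases]
    exact MatroidEntropy.log_card_bases_le M
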